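/- All Hilbert spaces are complex and separable, $\mathcal L(\mathcal X;\mathcal Y)$ denotes the bounded operators, $\mathcal L(\mathcal X)=\mathcal L(\mathcal X;\mathcal X)$, and $\otimes$ is the Hilbert space tensor product. A weakly closed *-algebra on $\mathcal H$ is a (not necessarily unital) *-subalgebra of $\mathcal L(\mathcal H)$ that is closed in the weak operator topology. It is called atomic if it has the form $$U\Big(0_{\mathcal H_0}\oplus\bigoplus_{i\in I}\big(\mathcal L(\mathcal H_{A_i})\otimes \mathbb 1_{B_i}\big)\Big)U^\dagger$$ for a countable index set $I$, Hilbert spaces $\mathcal H_0$, $\mathcal H_{A_i}$, $\mathcal H_{B_i}$ and a unitary $U:\mathcal H_0\oplus\bigoplus_{i\in I}(\mathcal H_{A_i}\otimes\mathcal H_{B_i})\to\mathcal H$; the elements of the direct sum are the operators $0\oplus\bigoplus_i (X_i\otimes\mathbb 1_{B_i})$ with $\sup_i\|X_i\|<\infty$. For such a presentation, let $P_0:\mathcal H\to\mathcal H_0$ and $P_i:\mathcal H\to\mathcal H_{A_i}\otimes\mathcal H_{B_i}$ be $U^\dagger$ followed by the orthogonal projection onto the respective summand. **Theorem.** Let $\mathcal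 A\subseteq\mathcal L(\mathcal H_{\mathcal A})$ and $\mathcal C\subseteq\mathcal L(\mathcal H_{\mathcal C})$ be atomic weakly closed *-algebras with given presentations as above: for $\mathcal A$ with index set $I$, spaces $\mathcal H_{0:\mathcal A},\mathcal H_{A_i},\mathcal H_{B_i}$ and projections $P_{0:\mathcal A},P_{i:\mathcal A}$; for $\mathcal C$ with index set $J$, spaces $\mathcal H_{0:\mathcal C},\mathcal H_{C_j},\mathcal H_{D_j}$ and projections $P_{0:\mathcal C},P_{j:\mathcal C}$. Let $\mathcal H_E$ be a Hilbert space, $V\in\mathcal L(\mathcal H_{\mathcal C};\mathcal H_{\mathcal A}\otimes\mathcal H_E)$, and let $\Phi:\mathcal L(\mathcal H_{\mathcal A})\to\mathcal L(\mathcal H_{\mathcal C})$ be the normal CP map $\Phi(X)=V^\dagger(X\otimes\mathbb 1_E)V$. Then the following are equivalent. 1. $\Phi(\mathcal A)\subseteq\mathcal C$. 2. There exist an operator $V_0\in\mathcal L(\mathcal H_{\mathcal C};\mathcal H_{0:\mathcal A}\otimes\mathcal H_E)$ and, for all $i\in I$ and $j\in J$, a Hilbert space $\mathcal H_{F_{ij}}$,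 an operator $A_{ij}\in\mathcal L(\mathcal H_{C_j};\mathcal H_{A_i}\otimes\mathcal H_{F_{ij}})$ and an isometry $U_{ij}\in\mathcal L(\mathcal H_{F_{ij}}\otimes\mathcal H_{D_j};\mathcal H_{B_i}\otimes\mathcal H_E)$ such that $$V=(P_{0:\mathcal A}^\dagger\otimes\mathbb 1_E)V_0+\sum_{i\in I,\,j\in J}(P_{i:\mathcal A}^\dagger\otimes\mathbb 1_E)V_{ij}P_{j:\mathcal C},\qquad V_{ij}=(\mathbb 1_{A_i}\otimes U_{ij})(A_{ij}\otimes\mathbb 1_{D_j}),$$ where the series converges in the strong operator topology, and such that $U_{ik}^\dagger U_{il}=\delta_{kl}\mathbb 1$ for all $i\in I$ and $k,l\in J$. Moreover, whenever these conditions hold, the representation in 2 can be chosen such that for all $i\in I$ and $j\in J$ the set $\{(X\otimes\mathbb 1_{F_{ij}})A_{ij}\psi \mid X\in\mathcal L(\mathcal H_{A_i}),\ \psi\in\mathcal H_{C_j}\}$ is total in $\mathcal H_{A_i}\otimes\mathcal H_{F_{ij}}$ (that is, its linear span is dense). -/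

import Mathlib

open scoped TensorProduct InnerProductSpace

universe u v w

noncomputable section

/-! ### The Hilbert space tensor product -/

/-- The Hilbert space tensor product: the completion of the algebraic tensor product with respect
to the inner product `⟪x ⊗ y, x' ⊗ y'⟫ = ⟪x, x'⟫ * ⟪y, y'⟫`. -/
def HilbertTensor (E : Type v) (F : Type w)
    [NormedAddCommGroup E] [InnerProductSpace ℂ E]
    [NormedAddCommGroup F] [InnerProductSpace ℂ F] : Type (max v w) :=
  UniformSpace.Completion (E ⊗[ℂ] F)

infixl:100 " ⊗ₕ " => HilbertTensor

namespace HilbertTensor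

section Basic

variable {E F G K : Type*}
  [NormedAddCommGroup E] [InnerProductSpace ℂ E]
  [NormedAddCommGroup F] [InnerProductSpace ℂ F]
  [NormedAddCommGroup G] [InnerProductSpace ℂ G]
  [NormedAddCommGroup K] [InnerProductSpace ℂ K]

instance : NormedAddCommGroup (E ⊗ₕ F) :=
  inferInstanceAs (NormedAddCommGroup (UniformSpace.Completion (E ⊗[ℂ] F)))

instance : InnerProductSpace ℂ (E ⊗ₕ F) :=
  inferInstanceAs (InnerProductSpace ℂ (UniformSpace.Completion (E ⊗[ℂ] F)))

instance : CompleteSpace (E ⊗ₕ F) :=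
  inferInstanceAs (CompleteSpace (UniformSpace.Completion (E ⊗[ℂ] F)))

variable (E F) in
/-- The isometric embedding of the algebraic tensor product. -/
def emb : E ⊗[ℂ] F →ₗᵢ[ℂ] E ⊗ₕ F :=
  (UniformSpace.Completion.toComplₗᵢ : E ⊗[ℂ] F →ₗᵢ[ℂ] UniformSpace.Completion (E ⊗[ℂ] F))

variable (E F) in
theorem denseRange_emb : DenseRange (emb E F) :=
  UniformSpace.Completion.denseRange_coe (α := E ⊗[ℂ] F)

/-- The elementary tensor `x ⊗ y`. -/
def tmul (x : E) (y : F) : E ⊗ₕ F := emb E F (x ⊗ₜ[ℂ] y)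

theorem inner_tmul (x x' : E) (y y' : F) :
    ⟪tmul x y, tmul x' y'⟫_ℂ = ⟪x, x'⟫_ℂ * ⟪y, y'⟫_ℂ := by
  rw [tmul, tmul, LinearIsometry.inner_map_map, TensorProduct.inner_tmul]

/-- The bounded operator `f ⊗ g`, the continuous extension of the algebraic one. -/
def map (f : E →L[ℂ] F) (g : G →L[ℂ] K) : E ⊗ₕ G →L[ℂ] F ⊗ₕ K :=
  ((TensorProduct.mapL f g).completion :
    UniformSpace.Completion (E ⊗[ℂ] G) →L[ℂ] UniformSpace.Completion (F ⊗[ℂ] K))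

theorem map_emb (f : E →L[ℂ] F) (g : G →L[ℂ] K) (z : E ⊗[ℂ] G) :
    map f g (emb E G z) = emb F K (TensorProduct.mapL f g z) :=
  ContinuousLinearMap.completion_apply_coe (TensorProduct.mapL f g) z

theorem map_tmul (f : E →L[ℂ] F) (g : G →L[ℂ] K) (x : E) (y : G) :
    map f g (tmul x y) = tmul (f x) (g y) := by
  rw [tmul, map_emb, TensorProduct.mapL_tmul, tmul]

/-- A continuous linear map with dense range induces a map with dense range on `- ⊗ G`. -/
theorem denseRange_rTensor {f : E →L[ℂ] F} (hf : DenseRange f) :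
    DenseRange (f.rTensor G) := by
  have key : ∀ z : F ⊗[ℂ] G, z ∈ (LinearMap.range (f.rTensor G).toLinearMap).topologicalClosure := by
    intro z
    induction z using TensorProduct.induction_on with
    | zero => exact zero_mem _
    | add x y hx hy => exact add_mem hx hy
    | tmul x y =>
      have hc : Continuous fun t : F => t ⊗ₜ[ℂ] y :=
        TensorProduct.continuous_tmul.comp (by fun_prop : Continuous fun t : F => (t, y))
      refine hf.induction_on
        (p := fun t => t ⊗ₜ[ℂ] y ∈
          (LinearMap.range (f.rTensor G).toLinearMap).topologicalClosure) x ?_ ?_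
      · exact (Submodule.isClosed_topologicalClosure _).preimage hc
      · intro t
        exact Submodule.le_topologicalClosure _ ⟨t ⊗ₜ[ℂ] y, rfl⟩
  intro z
  exact key z

/-- The analogous statement for `G ⊗ -`. -/
theorem denseRange_lTensor {f : E →L[ℂ] F} (hf : DenseRange f) :
    DenseRange (f.lTensor G) := by
  have h : ⇑(f.lTensor G) = ⇑(TensorProduct.commIsometry ℂ F G) ∘ ⇑(f.rTensor G) ∘
      ⇑(TensorProduct.commIsometry ℂ G E) := rfl
  rw [h]
  exact (TensorProduct.commIsometry ℂ F G).surjective.denseRange.comp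
    ((denseRange_rTensor hf).comp (TensorProduct.commIsometry ℂ G E).surjective.denseRange
      (f.rTensor G).continuous) (TensorProduct.commIsometry ℂ F G).continuous

variable (E F G)

/-- The isometric embedding of the algebraic tensor product `(E ⊗ F) ⊗ G` into
`(E ⊗ₕ F) ⊗ₕ G`. -/
def embL : (E ⊗[ℂ] F) ⊗[ℂ] G →ₗᵢ[ℂ] (E ⊗ₕ F) ⊗ₕ G :=
  (emb (E ⊗ₕ F) G).comp ((emb E F).rTensor G)

/-- The isometric embedding of the algebraic tensor product `E ⊗ (F ⊗ G)` into
`E ⊗ₕ (F ⊗ₕ G)`. -/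
def embR : E ⊗[ℂ] (F ⊗[ℂ] G) →ₗᵢ[ℂ] E ⊗ₕ (F ⊗ₕ G) :=
  (emb E (F ⊗ₕ G)).comp ((emb F G).lTensor E)

theorem denseRange_embL : DenseRange (embL E F G) := by
  have h : DenseRange ((emb E F).toContinuousLinearMap.rTensor G) :=
    denseRange_rTensor (denseRange_emb E F)
  exact (denseRange_emb (E ⊗ₕ F) G).comp h (emb (E ⊗ₕ F) G).continuous

theorem denseRange_embR : DenseRange (embR E F G) := by
  have h : DenseRange ((emb F G).toContinuousLinearMap.lTensor E) :=
    denseRange_lTensor (denseRange_emb F G)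
  rw [← LinearIsometry.toContinuousLinearMap_lTensor] at h
  exact (denseRange_emb E (F ⊗ₕ G)).comp h (emb E (F ⊗ₕ G)).continuous

/-- The canonical unitary `(E ⊗ F) ⊗ G ≃ E ⊗ (F ⊗ G)`. -/
def assoc : (E ⊗ₕ F) ⊗ₕ G ≃ₗᵢ[ℂ] E ⊗ₕ (F ⊗ₕ G) :=
  (TensorProduct.assocIsometry ℂ E F G).toLinearEquiv.extendOfIsometry
    (embL E F G).toLinearMap (embR E F G).toLinearMap
    (denseRange_embL E F G) (denseRange_embR E F G) (fun x => by
      simp only [LinearIsometry.coe_toLinearMap, LinearIsometry.norm_map,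
        LinearIsometryEquiv.coe_toLinearEquiv, LinearIsometryEquiv.norm_map])

variable {E F G}

theorem assoc_tmul (x : E) (y : F) (z : G) :
    assoc E F G (tmul (tmul x y) z) = tmul x (tmul y z) := by
  have h1 : tmul (tmul x y) z = (embL E F G).toLinearMap ((x ⊗ₜ[ℂ] y) ⊗ₜ[ℂ] z) := by
    simp [embL, tmul]
  have h2 : tmul x (tmul y z) = (embR E F G).toLinearMap (x ⊗ₜ[ℂ] (y ⊗ₜ[ℂ] z)) := by
    simp [embR, tmul]
  rw [h1, h2, assoc, LinearEquiv.extendOfIsometry_eq]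
  simp

end Basic

end HilbertTensor

/-- A subset of a Hilbert space is total if its linear span is dense. -/
def IsTotalSet {E : Type u} [NormedAddCommGroup E] [InnerProductSpace ℂ E] (S : Set E) : Prop :=
  Dense (Submodule.span ℂ S : Set E)

/-- The series `∑ k, T k` of bounded operators converges to `S` in the strong operator topology. -/
def SOTHasSum {ι : Type w} {E F : Type u}
    [NormedAddCommGroup E] [InnerProductSpace ℂ E]
    [NormedAddCommGroup F] [InnerProductSpace ℂ F]
    (T : ι → E →L[ℂ] F) (S : E →L[ℂ] F) : Prop :=
  ∀ ψ : E, HasSum (fun k => T k ψ) (S ψ)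

/-- A weakly closed *-algebra on `H`: a (not necessarily unital) *-subalgebra of the bounded
operators that is closed in the weak operator topology. -/
structure WeaklyClosedStarAlgebra (H : Type u)
    [NormedAddCommGroup H] [InnerProductSpace ℂ H] [CompleteSpace H]
    extends NonUnitalStarSubalgebra ℂ (H →L[ℂ] H) where
  isClosed_wot : IsClosed {T : H →WOT[ℂ] H | T.toCLM ∈ carrier}

section DirectSum

variable {I : Type v} (H₀ : Type u) (A B : I → Type u)
  [NormedAddCommGroup H₀] [InnerProductSpace ℂ H₀]
  [∀ i, NormedAddCommGroup (A i)] [∀ i, InnerProductSpace ℂ (A i)]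
  [∀ i, NormedAddCommGroup (B i)] [∀ i, InnerProductSpace ℂ (B i)]

/-- The Hilbert space `H₀ ⊕ ⨁ i, A i ⊗ B i`. -/
abbrev BlockSpace : Type (max u v) :=
  WithLp 2 (H₀ × lp (fun i => A i ⊗ₕ B i) 2)

/-- The set of operators `0 ⊕ ⨁ i, L(A i) ⊗ 1` on `H₀ ⊕ ⨁ i, A i ⊗ B i`, consisting of the
operators `0 ⊕ ⨁ i, x i ⊗ 1` with `sup i, ‖x i‖ < ∞`. -/
def blockAlgebra : Set (BlockSpace H₀ A B →L[ℂ] BlockSpace H₀ A B) :=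
  {X | ∃ x : ∀ i, A i →L[ℂ] A i, BddAbove (Set.range fun i => ‖x i‖) ∧
    ∀ ξ : BlockSpace H₀ A B, (X ξ).fst = 0 ∧
      ∀ i, (X ξ).snd i = HilbertTensor.map (x i) (.id ℂ (B i)) (ξ.snd i)}

end DirectSum

/-- A presentation of a weakly closed *-algebra `𝒜` as an atomic one:
`𝒜 = U (0 ⊕ ⨁ i, L(A i) ⊗ 1_{B i}) U†` with a countable index set, separable Hilbert spaces and a
unitary `U`. The algebra `𝒜` is atomic if it has such a presentation. -/
structure AtomicPresentation {H : Type u}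
    [NormedAddCommGroup H] [InnerProductSpace ℂ H] [CompleteSpace H]
    (𝒜 : WeaklyClosedStarAlgebra H) (I : Type v) where
  countable : Countable I
  H₀ : Type u
  [normH₀ : NormedAddCommGroup H₀]
  [innerH₀ : InnerProductSpace ℂ H₀]
  [completeH₀ : CompleteSpace H₀]
  [separableH₀ : TopologicalSpace.SeparableSpace H₀]
  A : I → Type u
  [normA : ∀ i, NormedAddCommGroup (A i)]
  [innerA : ∀ i, InnerProductSpace ℂ (A i)]
  [completeA : ∀ i, CompleteSpace (A i)]
  [separableA : ∀ i, TopologicalSpace.SeparableSpace (A i)]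
  B : I → Type u
  [normB : ∀ i, NormedAddCommGroup (B i)]
  [innerB : ∀ i, InnerProductSpace ℂ (B i)]
  [completeB : ∀ i, CompleteSpace (B i)]
  [separableB : ∀ i, TopologicalSpace.SeparableSpace (B i)]
  U : BlockSpace H₀ A B ≃ₗᵢ[ℂ] H
  algebra_eq : 𝒜.carrier =
    (fun X : BlockSpace H₀ A B →L[ℂ] BlockSpace H₀ A B =>
      (U : BlockSpace H₀ A B →L[ℂ] H) ∘L X ∘L (U.symm : H →L[ℂ] BlockSpace H₀ A B)) ''
      blockAlgebra H₀ A B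

namespace AtomicPresentation

attribute [instance] normH₀ innerH₀ completeH₀ separableH₀ normA innerA completeA separableA
  normB innerB completeB separableB

variable {H : Type u} [NormedAddCommGroup H] [InnerProductSpace ℂ H] [CompleteSpace H]
  {𝒜 : WeaklyClosedStarAlgebra H} {I : Type v} (a : AtomicPresentation 𝒜 I)

/-- `P₀ : H → H₀`, the projection onto the null part. -/
def P₀ : H →L[ℂ] a.H₀ :=
  WithLp.fstL 2 ℂ a.H₀ (lp (fun i => a.A i ⊗ₕ a.B i) 2) ∘L
    (a.U.symm : H →L[ℂ] BlockSpace a.H₀ a.A a.B)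

/-- `P i : H → A i ⊗ B i`, the projection onto the `i`-th block. -/
def P (i : I) : H →L[ℂ] a.A i ⊗ₕ a.B i :=
  lp.evalCLM ℂ (fun i => a.A i ⊗ₕ a.B i) 2 i ∘L
    WithLp.sndL 2 ℂ a.H₀ (lp (fun i => a.A i ⊗ₕ a.B i) 2) ∘L
      (a.U.symm : H →L[ℂ] BlockSpace a.H₀ a.A a.B)

end AtomicPresentation

section NormalForm

variable {HA HC HE : Type u}
  [NormedAddCommGroup HA] [InnerProductSpace ℂ HA] [CompleteSpace HA]
  [NormedAddCommGroup HC] [InnerProductSpace ℂ HC] [CompleteSpace HC]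
  [NormedAddCommGroup HE] [InnerProductSpace ℂ HE] [CompleteSpace HE]

/-- The semilocalizable operator `(1_A ⊗ U)(T ⊗ 1_D) : C ⊗ D → (A ⊗ B) ⊗ E`, where
`T : C → A ⊗ F` and `U : F ⊗ D → B ⊗ E` (the two bracketings of a threefold tensor product being
identified by the canonical unitary). -/
def semilocalizable {A B C D E F : Type u}
    [NormedAddCommGroup A] [InnerProductSpace ℂ A]
    [NormedAddCommGroup B] [InnerProductSpace ℂ B]
    [NormedAddCommGroup C] [InnerProductSpace ℂ C]
    [NormedAddCommGroup D] [InnerProductSpace ℂ D]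
    [NormedAddCommGroup E] [InnerProductSpace ℂ E]
    [NormedAddCommGroup F] [InnerProductSpace ℂ F]
    (U : F ⊗ₕ D →L[ℂ] B ⊗ₕ E) (T : C →L[ℂ] A ⊗ₕ F) : C ⊗ₕ D →L[ℂ] (A ⊗ₕ B) ⊗ₕ E :=
  ((HilbertTensor.assoc A B E).symm : A ⊗ₕ (B ⊗ₕ E) →L[ℂ] (A ⊗ₕ B) ⊗ₕ E) ∘L
    HilbertTensor.map (.id ℂ A) U ∘L
      (HilbertTensor.assoc A F D : (A ⊗ₕ F) ⊗ₕ D →L[ℂ] A ⊗ₕ (F ⊗ₕ D)) ∘L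
        HilbertTensor.map T (.id ℂ D)

/-- A block decomposition
`V = (P₀† ⊗ 1) V₀ + ∑ i j, (P i† ⊗ 1) (1 ⊗ U i j) (T i j ⊗ 1) P j`
of `V : HC → HA ⊗ HE` into semilocalizable blocks, with isometries `U i j` such that
`(U i k)† (U i l) = δ_{kl} 1`. The spaces `a.A i`, `a.B i` are the tensor factors of the blocks of
the first algebra, and `c.A j`, `c.B j` those of the second one. -/
structure NormalForm {𝒜 : WeaklyClosedStarAlgebra HA} {𝒞 : WeaklyClosedStarAlgebra HC}
    {I : Type v} {J : Type w} (a : AtomicPresentation 𝒜 I) (c : AtomicPresentation 𝒞 J)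
    (V : HC →L[ℂ] HA ⊗ₕ HE) where
  V₀ : HC →L[ℂ] a.H₀ ⊗ₕ HE
  F : I → J → Type u
  [normF : ∀ i j, NormedAddCommGroup (F i j)]
  [innerF : ∀ i j, InnerProductSpace ℂ (F i j)]
  [completeF : ∀ i j, CompleteSpace (F i j)]
  [separableF : ∀ i j, TopologicalSpace.SeparableSpace (F i j)]
  T : ∀ i j, c.A j →L[ℂ] a.A i ⊗ₕ F i j
  U : ∀ i j, F i j ⊗ₕ c.B j →L[ℂ] a.B i ⊗ₕ HE
  isometry_U : ∀ i j ψ, ‖U i j ψ‖ = ‖ψ‖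
  hasSum : SOTHasSum
    (fun p : I × J =>
      HilbertTensor.map (ContinuousLinearMap.adjoint (a.P p.1)) (.id ℂ HE) ∘L
        semilocalizable (U p.1 p.2) (T p.1 p.2) ∘L c.P p.2)
    (V - HilbertTensor.map (ContinuousLinearMap.adjoint a.P₀) (.id ℂ HE) ∘L V₀)
  adjoint_U_comp_self : ∀ i j,
    ContinuousLinearMap.adjoint (U i j) ∘L U i j = .id ℂ (F i j ⊗ₕ c.B j)
  adjoint_U_comp_of_ne : ∀ i k l, k ≠ l → ContinuousLinearMap.adjoint (U i k) ∘L U i l = 0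

namespace NormalForm

attribute [instance] normF innerF completeF separableF

/-- The operators `T i j` are minimal: for all `i` and `j` the vectors `(X ⊗ 1) (T i j) ψ` form a
total set. -/
def IsMinimal {𝒜 : WeaklyClosedStarAlgebra HA} {𝒞 : WeaklyClosedStarAlgebra HC}
    {I : Type v} {J : Type w} {a : AtomicPresentation 𝒜 I} {c : AtomicPresentation 𝒞 J}
    {V : HC →L[ℂ] HA ⊗ₕ HE} (N : NormalForm a c V) : Prop :=
  ∀ i j, IsTotalSet {ξ : a.A i ⊗ₕ N.F i j |
    ∃ (X : a.A i →L[ℂ] a.A i) (ψ : c.A j),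
      ξ = HilbertTensor.map X (.id ℂ (N.F i j)) (N.T i j ψ)}

end NormalForm

end NormalForm

end

noncomputable section

/-! Rebracketed, the `i`-th block of `V` is an operator `W_i : HC → A_i ⊗ (B_i ⊗ E)`, and condition
1 gives `W_i† (x ⊗ 1) W_i ∈ 𝒞` for every `x`. For `x = |a⟩⟨a'|` this describes the Gram matrix of
the slices `(⟨a| ⊗ 1) W_i ζ` in `B_i ⊗ E`: slices coming from different blocks `j` of `𝒞` are
orthogonal, and inside one block, for `ζ = ψ ⊗ d`, the Gram matrix is a kernel in `(a, ψ)` times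
`⟪d, d'⟫`. Let `F_ij` be the closed span of the slices at one fixed unit vector `d₀`. Then `slice(ψ
⊗ d₀) ⊗ d ↦ slice(ψ ⊗ d)` preserves Gram matrices, so it extends to the isometry `U_ij`, while `T_ij
ψ = W_i (ψ ⊗ d₀)` (`exists_linearIsometry_of_gram_eq`, `exists_semilocalization`). Minimality holds
by the choice of `F_ij`, orthogonality of slices gives `U_ik† U_il = 0`, and a Bessel inequality
yields convergence of the double series (`MapsAlgebra.hasSum`). The null part of `𝒜` imposes no
condition, so `V₀ = (P₀ ⊗ 1) V`.

Conversely, the series determines the blocks of `V`. The relations `U_ik† U_il = δ_kl` kill the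
off-diagonal blocks of `Φ(X)` and leave forms `b(ψ, ψ') ⟪d, d'⟫` on the diagonal, which belong to
operators `Y ⊗ 1` (`exists_eq_map_id`, `NormalForm.mapsAlgebra`). A minimal form is obtained from an
arbitrary one by returning to condition 1 and rebuilding. -/

theorem exists_inner_self_smul_eq (D : Type*) [NormedAddCommGroup D] [InnerProductSpace ℂ D] :
    ∃ d₀ : D, ‖d₀‖ ≤ 1 ∧ ∀ d : D, ⟪d₀, d₀⟫_ℂ • d = d := by
  rcases subsingleton_or_nontrivial D with hD | hD
  -- The zero space has no unit vector; stating the property as a scalar identity lets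
  -- zero-dimensional factors pass through later arguments without a case split.
  · exact ⟨0, by simp, fun d => Subsingleton.elim _ _⟩
  · obtain ⟨d₀, hd₀⟩ := exists_norm_eq D zero_le_one
    exact ⟨d₀, hd₀.le, fun d => by simp [inner_self_eq_norm_sq_to_K, hd₀]⟩

/-! ### Operators on Hilbert tensor products, and slice maps -/

namespace HilbertTensor

section Algebra

variable {E F G K E' G' X : Type*}
  [NormedAddCommGroup E] [InnerProductSpace ℂ E]
  [NormedAddCommGroup F] [InnerProductSpace ℂ F]
  [NormedAddCommGroup G] [InnerProductSpace ℂ G]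
  [NormedAddCommGroup K] [InnerProductSpace ℂ K]
  [NormedAddCommGroup E'] [InnerProductSpace ℂ E']
  [NormedAddCommGroup G'] [InnerProductSpace ℂ G']
  [NormedAddCommGroup X] [InnerProductSpace ℂ X]

variable (E F) in
/-- The elementary tensor as a continuous bilinear map. -/
def tmulL : E →L[ℂ] F →L[ℂ] E ⊗ₕ F :=
  (ContinuousLinearMap.compL ℂ F (E ⊗[ℂ] F) (E ⊗ₕ F) (emb E F).toContinuousLinearMap) ∘L
    TensorProduct.mkL ℂ E F

@[simp]
theorem tmulL_apply (x : E) (y : F) : tmulL E F x y = tmul x y := rfl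

theorem norm_tmul (x : E) (y : F) : ‖tmul x y‖ = ‖x‖ * ‖y‖ := by
  rw [tmul, LinearIsometry.norm_map, TensorProduct.norm_tmul]

theorem smul_tmul (r : ℂ) (x : E) (y : F) : tmul (r • x) y = r • tmul x y := by
  simp [← tmulL_apply]

theorem dense_span_tmul :
    Dense (Submodule.span ℂ (Set.range fun p : E × F => tmul p.1 p.2) : Set (E ⊗ₕ F)) := by
  refine (denseRange_emb E F).mono ?_
  rintro _ ⟨z, rfl⟩
  induction z using TensorProduct.induction_on with
  | zero => simp
  | add x y hx hy => rw [map_add]; exact add_mem hx hy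
  | tmul x y => exact Submodule.subset_span ⟨(x, y), rfl⟩

/-- Tensors of elements of two sets with dense span have dense span. -/
theorem dense_span_image2_tmul {S : Set E} {T : Set F}
    (hS : Dense (Submodule.span ℂ S : Set E)) (hT : Dense (Submodule.span ℂ T : Set F)) :
    Dense (Submodule.span ℂ (Set.image2 tmul S T) : Set (E ⊗ₕ F)) := by
  set M := (Submodule.span ℂ (Set.image2 tmul S T)).topologicalClosure with hM
  have hcl : IsClosed (M : Set (E ⊗ₕ F)) := Submodule.isClosed_topologicalClosure _
  have h1 : ∀ x ∈ S, ∀ y, tmul x y ∈ M := by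
    intro x hx y
    have hle : Submodule.span ℂ T ≤ M.comap (tmulL E F x).toLinearMap :=
      Submodule.span_le.2 fun t ht =>
        Submodule.le_topologicalClosure _ (Submodule.subset_span ⟨x, hx, t, ht, rfl⟩)
    exact (hcl.preimage (tmulL E F x).continuous).closure_subset_iff.2 hle (hT y)
  have h2 : ∀ x y, tmul x y ∈ M := by
    intro x y
    have hle : Submodule.span ℂ S ≤ M.comap ((tmulL E F).flip y).toLinearMap :=
      Submodule.span_le.2 fun s hs => h1 s hs y
    exact (hcl.preimage ((tmulL E F).flip y).continuous).closure_subset_iff.2 hle (hS x)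
  have h3 : Submodule.span ℂ (Set.range fun p : E × F => tmul p.1 p.2) ≤ M :=
    Submodule.span_le.2 (by rintro _ ⟨p, rfl⟩; exact h2 _ _)
  intro z
  exact hcl.closure_subset_iff.2 h3 (dense_span_tmul z)

theorem ext_tmul {f g : E ⊗ₕ F →L[ℂ] X} (h : ∀ x y, f (tmul x y) = g (tmul x y)) : f = g :=
  ContinuousLinearMap.ext_on dense_span_tmul (by rintro _ ⟨p, rfl⟩; exact h _ _)

theorem ext_inner_tmul {z z' : E ⊗ₕ F} (h : ∀ x y, ⟪tmul x y, z⟫_ℂ = ⟪tmul x y, z'⟫_ℂ) :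
    z = z' := by
  have : innerSL ℂ z = innerSL ℂ z' := ext_tmul fun x y => by
    simp only [innerSL_apply_apply]
    rw [← inner_conj_symm, h, inner_conj_symm]
  refine ext_inner_right ℂ fun w => ?_
  simpa using congrArg (fun f => f w) this

theorem map_comp_apply (f : F →L[ℂ] E') (g : K →L[ℂ] G') (f' : E →L[ℂ] F) (g' : G →L[ℂ] K)
    (z : E ⊗ₕ G) : map f g (map f' g' z) = map (f ∘L f') (g ∘L g') z := by
  have : map f g ∘L map f' g' = map (f ∘L f') (g ∘L g') :=
    ext_tmul fun x y => by simp [map_tmul]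
  exact congrArg (fun T => T z) this

theorem map_id_id : map (.id ℂ E) (.id ℂ F) = .id ℂ (E ⊗ₕ F) :=
  ext_tmul fun x y => by simp [map_tmul]

theorem map_zero_left (g : G →L[ℂ] K) : map (0 : E →L[ℂ] F) g = 0 :=
  ext_tmul fun x y => by
    rw [map_tmul, ← tmulL_apply]
    simp

theorem map_zero_right (f : E →L[ℂ] F) : map f (0 : G →L[ℂ] K) = 0 :=
  ext_tmul fun x y => by
    rw [map_tmul, zero_apply, ← tmulL_apply, (tmulL F K (f x)).map_zero, zero_apply]

theorem inner_map_left [CompleteSpace E] [CompleteSpace F] [CompleteSpace G] [CompleteSpace K]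
    (f : E →L[ℂ] F) (g : G →L[ℂ] K) (z : E ⊗ₕ G) (z' : F ⊗ₕ K) :
    ⟪map f g z, z'⟫_ℂ = ⟪z, map f.adjoint g.adjoint z'⟫_ℂ := by
  have : (map f g).adjoint = map f.adjoint g.adjoint := ext_tmul fun x y =>
    ext_inner_tmul fun x' y' => by
      rw [ContinuousLinearMap.adjoint_inner_right, map_tmul, map_tmul, inner_tmul, inner_tmul,
        ContinuousLinearMap.adjoint_inner_right, ContinuousLinearMap.adjoint_inner_right]
  rw [← this, ContinuousLinearMap.adjoint_inner_right]

theorem inner_map_right [CompleteSpace E] [CompleteSpace F] [CompleteSpace G] [CompleteSpace K]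
    (f : E →L[ℂ] F) (g : G →L[ℂ] K) (z : E ⊗ₕ G) (z' : F ⊗ₕ K) :
    ⟪z', map f g z⟫_ℂ = ⟪map f.adjoint g.adjoint z', z⟫_ℂ := by
  rw [← inner_conj_symm, inner_map_left, inner_conj_symm]

theorem assoc_map (f : E →L[ℂ] E') (g : F →L[ℂ] G') (h : G →L[ℂ] K) (z : (E ⊗ₕ F) ⊗ₕ G) :
    assoc E' G' K (map (map f g) h z) = map f (map g h) (assoc E F G z) := by
  have : (assoc E' G' K : (E' ⊗ₕ G') ⊗ₕ K →L[ℂ] E' ⊗ₕ (G' ⊗ₕ K)) ∘L map (map f g) h =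
      map f (map g h) ∘L (assoc E F G : (E ⊗ₕ F) ⊗ₕ G →L[ℂ] E ⊗ₕ (F ⊗ₕ G)) := by
    refine ContinuousLinearMap.ext_on (dense_span_image2_tmul (dense_span_tmul (E := E) (F := F))
      (T := Set.univ) (by simp)) ?_
    rintro _ ⟨_, ⟨⟨x, y⟩, rfl⟩, t, -, rfl⟩
    simp [map_tmul, assoc_tmul]
  exact congrArg (fun T => T z) this

end Algebra

/-- An operator on `A ⊗ K` whose sesquilinear form is a product with the inner product of `K` is
of the form `Y ⊗ 1`. -/
theorem exists_eq_map_id {A K : Type*}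
    [NormedAddCommGroup A] [InnerProductSpace ℂ A] [CompleteSpace A]
    [NormedAddCommGroup K] [InnerProductSpace ℂ K] (S : A ⊗ₕ K →L[ℂ] A ⊗ₕ K) (b : A → A → ℂ)
    (hS : ∀ x k x' k', ⟪tmul x k, S (tmul x' k')⟫_ℂ = b x x' * ⟪k, k'⟫_ℂ) :
    ∃ Y : A →L[ℂ] A, ‖Y‖ ≤ ‖S‖ ∧ S = map Y (.id ℂ K) := by
  -- `Y` is the compression of `S` along the contraction `x ↦ x ⊗ d₀`, which also gives the norm
  -- bound; boundedness of `b` is never needed.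
  obtain ⟨d₀, hd₁, hd₀⟩ := exists_inner_self_smul_eq K
  set t : A →L[ℂ] A ⊗ₕ K := (tmulL A K).flip d₀ with ht
  have htn : ‖t‖ ≤ 1 := t.opNorm_le_bound zero_le_one fun x => by
    rw [ht, ContinuousLinearMap.flip_apply, tmulL_apply, norm_tmul, mul_comm]
    gcongr
  refine ⟨t.adjoint ∘L S ∘L t, ?_, ext_tmul fun x' k' => ext_inner_tmul fun x k => ?_⟩
  · calc ‖t.adjoint ∘L S ∘L t‖ ≤ ‖t.adjoint‖ * (‖S‖ * ‖t‖) :=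
          (ContinuousLinearMap.opNorm_comp_le _ _).trans
            (by gcongr; exact ContinuousLinearMap.opNorm_comp_le _ _)
      _ ≤ 1 * (‖S‖ * 1) := by
          rw [LinearIsometryEquiv.norm_map]
          gcongr
      _ = ‖S‖ := by ring
  · rw [hS, map_tmul, inner_tmul, ContinuousLinearMap.comp_apply, ContinuousLinearMap.comp_apply,
      ContinuousLinearMap.adjoint_inner_right]
    simp only [ht, ContinuousLinearMap.flip_apply, tmulL_apply, hS, ContinuousLinearMap.id_apply]
    rw [mul_assoc, ← inner_smul_right k k' ⟪d₀, d₀⟫_ℂ, hd₀]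

section Slice

variable {A K L D F : Type*}
  [NormedAddCommGroup A] [InnerProductSpace ℂ A]
  [NormedAddCommGroup K] [InnerProductSpace ℂ K] [CompleteSpace K]
  [NormedAddCommGroup L] [InnerProductSpace ℂ L] [CompleteSpace L]
  [NormedAddCommGroup D] [InnerProductSpace ℂ D]
  [NormedAddCommGroup F] [InnerProductSpace ℂ F] [CompleteSpace F]

/-- The slice map `⟨x| ⊗ 1 : A ⊗ K → K`. -/
def slice (x : A) : A ⊗ₕ K →L[ℂ] K := (tmulL A K x).adjoint

theorem inner_slice_right (x : A) (k : K) (z : A ⊗ₕ K) : ⟪k, slice x z⟫_ℂ = ⟪tmul x k, z⟫_ℂ := by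
  rw [slice, ContinuousLinearMap.adjoint_inner_right, tmulL_apply]

theorem inner_slice_left (x : A) (k : K) (z : A ⊗ₕ K) : ⟪slice x z, k⟫_ℂ = ⟪z, tmul x k⟫_ℂ := by
  rw [← inner_conj_symm, inner_slice_right, inner_conj_symm]

theorem slice_tmul (x y : A) (k : K) : slice x (tmul y k) = ⟪x, y⟫_ℂ • k :=
  ext_inner_left ℂ fun l => by
    rw [inner_slice_right, inner_tmul, inner_smul_right]

theorem tmul_slice (x y : A) (z : A ⊗ₕ K) :
    tmul x (slice y z) = map (InnerProductSpace.rankOne ℂ x y) (.id ℂ K) z := by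
  have : tmulL A K x ∘L slice y = map (InnerProductSpace.rankOne ℂ x y) (.id ℂ K) :=
    ext_tmul fun a k => by
      simp [slice_tmul, map_tmul, smul_tmul]
  exact congrArg (fun T => T z) this

theorem slice_map_id (x : A) (f : K →L[ℂ] L) (z : A ⊗ₕ K) :
    slice x (map (.id ℂ A) f z) = f (slice x z) := by
  have : slice x ∘L map (.id ℂ A) f = f ∘L slice x :=
    ext_tmul fun a k => by simp [slice_tmul, map_tmul]
  exact congrArg (fun T => T z) this

theorem ext_slice {z z' : A ⊗ₕ K} (h : ∀ x, slice x z = slice x z') : z = z' :=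
  ext_inner_tmul fun x k => by rw [← inner_slice_right, h, inner_slice_right]

/-- Since `|x⟩⟨x'| ⊗ 1` slices with `x'` and tensors back with `x`, Gram matrices of slices become
matrix elements of `L(A) ⊗ 1`. This is how the hypothesis on `Φ` reaches them. -/
theorem inner_slice_slice (x x' : A) (z z' : A ⊗ₕ K) :
    ⟪slice x z, slice x' z'⟫_ℂ =
      ⟪z, map (InnerProductSpace.rankOne ℂ x x') (.id ℂ K) z'⟫_ℂ := by
  rw [inner_slice_left, tmul_slice]

theorem slice_assoc_tmul (x : A) (z : A ⊗ₕ F) (d : D) :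
    slice x (assoc A F D (tmul z d)) = tmul (slice x z) d := by
  have : slice x ∘L (assoc A F D : (A ⊗ₕ F) ⊗ₕ D →L[ℂ] A ⊗ₕ (F ⊗ₕ D)) ∘L (tmulL _ D).flip d =
      (tmulL F D).flip d ∘L slice x :=
    ext_tmul fun a k => by simp [slice_tmul, assoc_tmul]
  exact congrArg (fun T => T z) this

theorem continuous_slice {Y : Type*} [TopologicalSpace Y] {f : Y → A} {g : Y → A ⊗ₕ K}
    (hf : Continuous f) (hg : Continuous g) : Continuous fun p => slice (f p) (g p) := by
  have h1 : Continuous fun x : A => (slice x : A ⊗ₕ K →L[ℂ] K) :=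
    (ContinuousLinearMap.adjoint (𝕜 := ℂ) (E := K) (F := A ⊗ₕ K)).continuous.comp
      (tmulL A K).continuous
  exact (h1.comp hf).clm_apply hg

attribute [irreducible] slice

end Slice

end HilbertTensor

/-! ### Isometries from Gram matrices, and Bessel's inequality -/

section GramMatrix

variable {ι X Y : Type*} [NormedAddCommGroup X] [InnerProductSpace ℂ X]
  [NormedAddCommGroup Y] [InnerProductSpace ℂ Y] [CompleteSpace Y]

/-- Two families with the same Gram matrix, the first one total, are related by an isometry. -/
theorem exists_linearIsometry_of_gram_eq (x : ι → X) (y : ι → Y)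
    (hx : IsTotalSet (Set.range x)) (h : ∀ i j, ⟪x i, x j⟫_ℂ = ⟪y i, y j⟫_ℂ) :
    ∃ f : X →ₗᵢ[ℂ] Y, ∀ i, f (x i) = y i := by
  set e := Finsupp.linearCombination ℂ x
  set g := Finsupp.linearCombination ℂ y
  -- Equal Gram matrices give equal norms of all linear combinations, so `e v ↦ g v` is well defined
  -- and isometric on the dense range of `e`.
  have hn : ∀ v, ‖g v‖ = ‖e v‖ := by
    intro v
    have : ⟪g v, g v⟫_ℂ = ⟪e v, e v⟫_ℂ := by
      simp only [e, g, Finsupp.linearCombination_apply, Finsupp.sum, sum_inner, inner_sum,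
        inner_smul_left, inner_smul_right, h]
    rw [@norm_eq_sqrt_re_inner ℂ, @norm_eq_sqrt_re_inner ℂ _ _ _ _ (e v), this]
  have hd : DenseRange e := by
    rw [DenseRange, ← LinearMap.coe_range, Finsupp.range_linearCombination]
    exact hx
  have hC : ∃ C, ∀ v, ‖g v‖ ≤ C * ‖e v‖ := ⟨1, fun v => by rw [hn, one_mul]⟩
  have he : ∀ v, g.extendOfNorm e (e v) = g v := LinearMap.extendOfNorm_eq hd hC
  refine ⟨⟨(g.extendOfNorm e).toLinearMap, fun z => ?_⟩, fun i => ?_⟩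
  · refine hd.induction_on (p := fun z => ‖g.extendOfNorm e z‖ = ‖z‖) z
      (isClosed_eq (by fun_prop) (by fun_prop)) fun v => ?_
    rw [he, hn]
  · have := he (Finsupp.single i 1)
    simpa [e, g] using this

end GramMatrix

/-- Bessel's inequality for a family of pairwise orthogonal components of a vector. -/
theorem summable_of_orthogonal_of_inner_eq {ι X : Type*} [NormedAddCommGroup X]
    [InnerProductSpace ℂ X] [CompleteSpace X] (x : ι → X) (y : X)
    (h : ∀ i j, i ≠ j → ⟪x i, x j⟫_ℂ = 0) (hy : ∀ i, ⟪x i, y⟫_ℂ = ⟪x i, x i⟫_ℂ) :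
    Summable x := by
  classical
  have hs : ∀ s : Finset ι, ⟪∑ i ∈ s, x i, ∑ i ∈ s, x i⟫_ℂ = ∑ i ∈ s, ⟪x i, x i⟫_ℂ := by
    intro s
    rw [sum_inner]
    refine Finset.sum_congr rfl fun i hi => ?_
    rw [inner_sum, Finset.sum_eq_single i (fun j _ hj => h i j hj.symm) (fun hi' => absurd hi hi')]
  have hs' : ∀ s : Finset ι, ‖∑ i ∈ s, x i‖ ^ 2 = ∑ i ∈ s, ‖x i‖ ^ 2 := by
    intro s
    have := hs s
    simp only [inner_self_eq_norm_sq_to_K] at this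
    exact_mod_cast this
  -- A partial sum `σ` satisfies `⟪σ, y⟫ = ‖σ‖²`, hence `‖σ‖ ≤ ‖y‖` by Cauchy–Schwarz.
  have hle : ∀ s : Finset ι, ∑ i ∈ s, ‖x i‖ ^ 2 ≤ ‖y‖ ^ 2 := by
    intro s
    have h1 : ⟪∑ i ∈ s, x i, y⟫_ℂ = ⟪∑ i ∈ s, x i, ∑ i ∈ s, x i⟫_ℂ := by
      rw [hs, sum_inner]
      exact Finset.sum_congr rfl fun i _ => hy i
    have h2 := norm_inner_le_norm (𝕜 := ℂ) (∑ i ∈ s, x i) y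
    rw [h1, inner_self_eq_norm_sq_to_K, norm_pow, RCLike.norm_ofReal, abs_norm] at h2
    rw [← hs' s]
    have h3 : ‖∑ i ∈ s, x i‖ ≤ ‖y‖ := by
      by_contra hlt
      push Not at hlt
      nlinarith [norm_nonneg y]
    gcongr
  have hsum : Summable fun i => ‖x i‖ ^ 2 :=
    summable_of_sum_le (fun i => by positivity) hle
  rw [summable_iff_vanishing_norm] at hsum ⊢
  intro ε hε
  obtain ⟨s, hsε⟩ := hsum (ε ^ 2) (by positivity)
  refine ⟨s, fun t ht => ?_⟩
  have := hsε t ht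
  rw [← hs', Real.norm_of_nonneg (by positivity)] at this
  exact lt_of_pow_lt_pow_left₀ 2 hε.le this

/-! ### Factorization of a single block -/

section Factorization

open HilbertTensor

/-- The vectors of a continuous family span a dense subspace of some closed subspace. -/
theorem exists_submodule_dense_span {ι K : Type*} [TopologicalSpace ι]
    [TopologicalSpace.SeparableSpace ι] [NormedAddCommGroup K] [InnerProductSpace ℂ K]
    [CompleteSpace K] (k : ι → K) (hk : Continuous k) :
    ∃ (F : Submodule ℂ K) (_ : CompleteSpace F) (_ : TopologicalSpace.SeparableSpace F)
      (kF : ι → F), (∀ i, (kF i : K) = k i) ∧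
        Dense (Submodule.span ℂ (Set.range kF) : Set F) := by
  have hsep : TopologicalSpace.IsSeparable
      ((Submodule.span ℂ (Set.range k)).topologicalClosure : Set K) :=
    (TopologicalSpace.isSeparable_range hk).span.closure
  refine ⟨(Submodule.span ℂ (Set.range k)).topologicalClosure,
    (Submodule.isClosed_topologicalClosure _).completeSpace_coe, hsep.separableSpace,
    fun i => ⟨k i, Submodule.le_topologicalClosure _ (Submodule.subset_span ⟨i, rfl⟩)⟩,
    fun i => rfl, fun f => ?_⟩
  rw [closure_subtype, ← Submodule.coe_subtype, ← Submodule.map_coe, Submodule.map_span,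
    ← Set.range_comp]
  exact f.2

variable {A C D K : Type*}
  [NormedAddCommGroup A] [InnerProductSpace ℂ A]
  [NormedAddCommGroup C] [InnerProductSpace ℂ C]
  [NormedAddCommGroup D] [InnerProductSpace ℂ D]
  [NormedAddCommGroup K] [InnerProductSpace ℂ K] [CompleteSpace K]

/-- If `X ↦ W† (X ⊗ 1) W` maps `L(A)` to `L(C) ⊗ 1`, then `W : C ⊗ D → A ⊗ K` factors as
`(1 ⊗ U) (T ⊗ 1)` with a minimal `T : C → A ⊗ F` and an isometry `U : F ⊗ D → K`. -/
theorem exists_semilocalization [TopologicalSpace.SeparableSpace A]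
    [TopologicalSpace.SeparableSpace C] (W : C ⊗ₕ D →L[ℂ] A ⊗ₕ K)
    (hW : ∀ X : A →L[ℂ] A, ∃ Y : C →L[ℂ] C, ∀ ζ ζ' : C ⊗ₕ D,
      ⟪W ζ, map X (.id ℂ K) (W ζ')⟫_ℂ = ⟪ζ, map Y (.id ℂ D) ζ'⟫_ℂ) :
    ∃ (F : Submodule ℂ K) (_ : CompleteSpace F) (_ : TopologicalSpace.SeparableSpace F)
      (T : C →L[ℂ] A ⊗ₕ F) (U : F ⊗ₕ D →ₗᵢ[ℂ] K),
      (∀ ζ, map (.id ℂ A) U.toContinuousLinearMap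
        (assoc A F D (map T (.id ℂ D) ζ)) = W ζ) ∧
      IsTotalSet {ξ : A ⊗ₕ F | ∃ (X : A →L[ℂ] A) (ψ : C), ξ = map X (.id ℂ F) (T ψ)} ∧
      ∀ z, (∀ x ζ, ⟪slice x (W ζ), z⟫_ℂ = 0) → ∀ f, ⟪U f, z⟫_ℂ = 0 := by
  obtain ⟨d₀, -, hd₀⟩ := exists_inner_self_smul_eq D
  let k : A × C → K := fun p => slice p.1 (W (tmul p.2 d₀))
  have hk : Continuous k := by
    have h1 : Continuous fun p : A × C => tmul p.2 d₀ :=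
      ((tmulL C D).flip d₀).continuous.comp continuous_snd
    exact continuous_slice continuous_fst (W.continuous.comp h1)
  obtain ⟨F, hcomplete, hsep, kF, hkF, hdense⟩ := exists_submodule_dense_span k hk
  -- `U` is prescribed by `x q ↦ y q`: the slice at `d₀`, tensored with `d`, goes to the slice at
  -- `d`.
  let x : A × C × D → F ⊗ₕ D := fun q => tmul (kF (q.1, q.2.1)) q.2.2
  let y : A × C × D → K := fun q => slice q.1 (W (tmul q.2.1 q.2.2))
  have hx : IsTotalSet (Set.range x) := by
    have := dense_span_image2_tmul (T := (Set.univ : Set D)) hdense (by simp)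
    refine this.mono (Submodule.span_mono ?_)
    rintro _ ⟨_, ⟨p, rfl⟩, d, -, rfl⟩
    exact ⟨(p.1, p.2, d), rfl⟩
  have hgram : ∀ q q', ⟪x q, x q'⟫_ℂ = ⟪y q, y q'⟫_ℂ := by
    rintro ⟨a, ψ, d⟩ ⟨a', ψ', d'⟩
    -- Both entries equal `⟪ψ, Y ψ'⟫ ⟪d, d'⟫`; the left one has an extra factor `⟪d₀, d₀⟫`, which
    -- `hd₀` absorbs into `d'`.
    obtain ⟨Y, hY⟩ := hW (InnerProductSpace.rankOne ℂ a a')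
    have h1 : ⟪kF (a, ψ), kF (a', ψ')⟫_ℂ = ⟪k (a, ψ), k (a', ψ')⟫_ℂ := by
      rw [Submodule.coe_inner, hkF, hkF]
    simp only [x, y, k, inner_tmul, h1, inner_slice_slice, hY, map_tmul,
      ContinuousLinearMap.id_apply]
    rw [mul_assoc, ← inner_smul_right d, hd₀]
  obtain ⟨U, hU⟩ := exists_linearIsometry_of_gram_eq x y hx hgram
  -- All slices of `W (ψ ⊗ d₀)` lie in `F`, so the projection only changes the codomain.
  let T : C →L[ℂ] A ⊗ₕ F :=
    map (.id ℂ A) F.orthogonalProjectionOnto ∘L W ∘L (tmulL C D).flip d₀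
  have hT : ∀ a ψ, slice a (T ψ) = kF (a, ψ) := by
    intro a ψ
    change slice a (map (.id ℂ A) F.orthogonalProjectionOnto (W (tmul ψ d₀))) = _
    rw [slice_map_id, show slice a (W (tmul ψ d₀)) = kF (a, ψ) from (hkF (a, ψ)).symm]
    exact F.orthogonalProjectionOnto_mem_subspace_eq_self (kF (a, ψ))
  refine ⟨F, hcomplete, hsep, T, U, ?_, ?_, ?_⟩
  · have : map (.id ℂ A) U.toContinuousLinearMap ∘L
        (assoc A F D : (A ⊗ₕ F) ⊗ₕ D →L[ℂ] A ⊗ₕ (F ⊗ₕ D)) ∘L map T (.id ℂ D) = W := by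
      refine ext_tmul fun ψ d => ext_slice fun a => ?_
      simp only [ContinuousLinearMap.comp_apply, slice_map_id, map_tmul]
      erw [slice_assoc_tmul, hT]
      exact hU (a, ψ, d)
    exact fun ζ => congrArg (fun T => T ζ) this
  · have := dense_span_image2_tmul (S := (Set.univ : Set A)) (by simp) hdense
    refine this.mono (Submodule.span_mono ?_)
    rintro _ ⟨a', -, _, ⟨p, rfl⟩, rfl⟩
    -- `|a'⟩⟨a| ⊗ 1` maps `T ψ` to `a' ⊗ kF (a, ψ)`, and these tensors are total.
    exact ⟨InnerProductSpace.rankOne ℂ a' p.1, p.2, by rw [← tmul_slice, hT]⟩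
  · intro z hz f
    have h0 : innerSL ℂ z ∘L U.toContinuousLinearMap = 0 := by
      refine ContinuousLinearMap.ext_on hx ?_
      rintro _ ⟨q, rfl⟩
      have := hz q.1 (tmul q.2.1 q.2.2)
      simp only [ContinuousLinearMap.comp_apply, LinearIsometry.coe_toContinuousLinearMap, hU,
        innerSL_apply_apply, zero_apply]
      rw [← inner_conj_symm, this, map_zero]
    rw [← inner_conj_symm]
    have := congrArg (fun T => T f) h0
    simp only [ContinuousLinearMap.comp_apply, LinearIsometry.coe_toContinuousLinearMap,
      innerSL_apply_apply, zero_apply] at this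
    rw [this, map_zero]

end Factorization

/-! ### Calculus of the block projections -/

namespace AtomicPresentation

open HilbertTensor

variable {H : Type u} [NormedAddCommGroup H] [InnerProductSpace ℂ H] [CompleteSpace H]
  {𝒜 : WeaklyClosedStarAlgebra H} {I : Type v} (a : AtomicPresentation 𝒜 I)

theorem P₀_apply (η : H) : a.P₀ η = (a.U.symm η).fst := rfl

theorem P_apply (i : I) (η : H) : a.P i η = (a.U.symm η).snd i := rfl

theorem adjoint_P₀_apply (ξ : a.H₀) :
    a.P₀.adjoint ξ = a.U (WithLp.toLp 2 (ξ, 0)) :=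
  ext_inner_right ℂ fun η => by
    rw [ContinuousLinearMap.adjoint_inner_left, P₀_apply, ← a.U.symm.inner_map_map,
      LinearIsometryEquiv.symm_apply_apply, WithLp.prod_inner_apply]
    simp

theorem adjoint_P_apply [DecidableEq I] (i : I) (ξ : a.A i ⊗ₕ a.B i) :
    (a.P i).adjoint ξ = a.U (WithLp.toLp 2 (0, lp.single 2 i ξ)) :=
  ext_inner_right ℂ fun η => by
    rw [ContinuousLinearMap.adjoint_inner_left, P_apply, ← a.U.symm.inner_map_map,
      LinearIsometryEquiv.symm_apply_apply, WithLp.prod_inner_apply]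
    simp [lp.inner_single_left]

theorem P_adjoint_P₀ (i : I) (ξ : a.H₀) : a.P i (a.P₀.adjoint ξ) = 0 := by
  rw [adjoint_P₀_apply, P_apply, LinearIsometryEquiv.symm_apply_apply]
  rfl

theorem P₀_adjoint_P (i : I) (ξ : a.A i ⊗ₕ a.B i) : a.P₀ ((a.P i).adjoint ξ) = 0 := by
  classical
  simp [adjoint_P_apply, P₀_apply]

theorem P_adjoint_P_self (i : I) (ξ : a.A i ⊗ₕ a.B i) : a.P i ((a.P i).adjoint ξ) = ξ := by
  classical
  rw [adjoint_P_apply, P_apply, LinearIsometryEquiv.symm_apply_apply]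
  exact lp.single_apply_self _ _ _

theorem P_adjoint_P_of_ne {i k : I} (h : k ≠ i) (ξ : a.A i ⊗ₕ a.B i) :
    a.P k ((a.P i).adjoint ξ) = 0 := by
  classical
  rw [adjoint_P_apply, P_apply, LinearIsometryEquiv.symm_apply_apply]
  exact lp.single_apply_ne _ _ _ h

theorem hasSum_adjoint_P (η : H) :
    HasSum (fun i => (a.P i).adjoint (a.P i η)) (η - a.P₀.adjoint (a.P₀ η)) := by
  classical
  let f : lp (fun i => a.A i ⊗ₕ a.B i) 2 →L[ℂ] H :=
    (a.U : BlockSpace a.H₀ a.A a.B →L[ℂ] H) ∘L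
      ((WithLp.prodContinuousLinearEquiv 2 ℂ a.H₀ (lp (fun i => a.A i ⊗ₕ a.B i) 2)).symm :
        a.H₀ × lp (fun i => a.A i ⊗ₕ a.B i) 2 →L[ℂ] BlockSpace a.H₀ a.A a.B) ∘L
      ContinuousLinearMap.inr ℂ a.H₀ (lp (fun i => a.A i ⊗ₕ a.B i) 2)
  have hf : ∀ x, f x = a.U (WithLp.toLp 2 (0, x)) := fun _ => rfl
  have h1 := (lp.hasSum_single (by simp) (a.U.symm η).snd).mapL f
  simp only [hf, ← P_apply, ← adjoint_P_apply] at h1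
  convert h1 using 1
  rw [adjoint_P₀_apply, P₀_apply, sub_eq_iff_eq_add, ← map_add]
  apply a.U.symm.injective
  rw [LinearIsometryEquiv.symm_apply_apply]
  apply (WithLp.ofLp_injective 2)
  ext1 <;> simp

/-- Expresses membership through the projections alone, so that the unitary of the presentation
plays no role in later membership arguments. -/
theorem mem_carrier_iff (S : H →L[ℂ] H) :
    S ∈ 𝒜.carrier ↔ (∀ η, a.P₀ (S η) = 0) ∧
      ∃ y : ∀ i, a.A i →L[ℂ] a.A i, BddAbove (Set.range fun i => ‖y i‖) ∧
        ∀ i η, a.P i (S η) = map (y i) (.id ℂ (a.B i)) (a.P i η) := by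
  rw [a.algebra_eq]
  constructor
  · rintro ⟨X, ⟨y, hb, hX⟩, rfl⟩
    refine ⟨fun η => ?_, y, hb, fun i η => ?_⟩
    · rw [P₀_apply]
      simpa using (hX (a.U.symm η)).1
    · rw [P_apply, P_apply]
      simpa using (hX (a.U.symm η)).2 i
  · rintro ⟨h0, y, hb, hy⟩
    refine ⟨(a.U.symm : H →L[ℂ] BlockSpace a.H₀ a.A a.B) ∘L S ∘L
      (a.U : BlockSpace a.H₀ a.A a.B →L[ℂ] H), ⟨y, hb, fun ξ => ⟨?_, fun i => ?_⟩⟩, ?_⟩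
    · exact h0 (a.U ξ)
    · have := hy i (a.U ξ)
      rwa [P_apply, P_apply, LinearIsometryEquiv.symm_apply_apply] at this
    · ext η
      simp

theorem norm_adjoint_P (i : I) (ξ : a.A i ⊗ₕ a.B i) : ‖(a.P i).adjoint ξ‖ = ‖ξ‖ := by
  rw [@norm_eq_sqrt_re_inner ℂ, ContinuousLinearMap.adjoint_inner_left, P_adjoint_P_self,
    ← @norm_eq_sqrt_re_inner ℂ]

theorem norm_P_comp_comp_adjoint_P_le (i : I) (S : H →L[ℂ] H) :
    ‖a.P i ∘L S ∘L (a.P i).adjoint‖ ≤ ‖S‖ := by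
  have h : ‖(a.P i).adjoint‖ ≤ 1 := ContinuousLinearMap.opNorm_le_bound _ zero_le_one fun ξ => by
    rw [norm_adjoint_P, one_mul]
  have h' : ‖a.P i‖ ≤ 1 := by rwa [LinearIsometryEquiv.norm_map] at h
  calc ‖a.P i ∘L S ∘L (a.P i).adjoint‖ ≤ ‖a.P i‖ * (‖S‖ * ‖(a.P i).adjoint‖) :=
        (ContinuousLinearMap.opNorm_comp_le _ _).trans
          (by gcongr; exact ContinuousLinearMap.opNorm_comp_le _ _)
    _ ≤ 1 * (‖S‖ * 1) := by gcongr
    _ = ‖S‖ := by ring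

theorem ext_adjoint {X : Type*} [NormedAddCommGroup X] [NormedSpace ℂ X] {f g : H →L[ℂ] X}
    (h₀ : ∀ ξ, f (a.P₀.adjoint ξ) = g (a.P₀.adjoint ξ))
    (h : ∀ i ξ, f ((a.P i).adjoint ξ) = g ((a.P i).adjoint ξ)) : f = g := by
  ext η
  have h1 := (a.hasSum_adjoint_P η).mapL f
  have h2 := (a.hasSum_adjoint_P η).mapL g
  simp only [h] at h1
  have h3 := h1.unique h2
  rwa [map_sub, map_sub, h₀, sub_left_inj] at h3

/-- Elements supported on one block are the test operators on which `Φ(𝒜) ⊆ 𝒞` is evaluated. -/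
theorem adjoint_P_comp_map_mem (i : I) (x : a.A i →L[ℂ] a.A i) :
    (a.P i).adjoint ∘L map x (.id ℂ (a.B i)) ∘L a.P i ∈ 𝒜.carrier := by
  classical
  rw [a.mem_carrier_iff]
  refine ⟨fun η => a.P₀_adjoint_P i _, Pi.single i x, ?_, fun k η => ?_⟩
  · refine ⟨‖x‖, ?_⟩
    rintro _ ⟨k, rfl⟩
    rcases eq_or_ne k i with rfl | hk
    · simp
    · simp [Pi.single_eq_of_ne hk]
  · rcases eq_or_ne k i with rfl | hk
    · simp [P_adjoint_P_self]
    · simp [P_adjoint_P_of_ne _ hk, Pi.single_eq_of_ne hk, map_zero_left]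

section Ampliation

variable {E : Type*} [NormedAddCommGroup E] [InnerProductSpace ℂ E]

theorem map_P_adjoint_P_self (i : I) (ξ : (a.A i ⊗ₕ a.B i) ⊗ₕ E) :
    map (a.P i) (.id ℂ E) (map (a.P i).adjoint (.id ℂ E) ξ) = ξ := by
  rw [map_comp_apply, show a.P i ∘L (a.P i).adjoint = .id ℂ _ from
    ContinuousLinearMap.ext (a.P_adjoint_P_self i), ContinuousLinearMap.comp_id, map_id_id]
  rfl

theorem map_P_adjoint_P_of_ne {i k : I} (h : k ≠ i) (ξ : (a.A i ⊗ₕ a.B i) ⊗ₕ E) :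
    map (a.P k) (.id ℂ E) (map (a.P i).adjoint (.id ℂ E) ξ) = 0 := by
  rw [map_comp_apply, show a.P k ∘L (a.P i).adjoint = 0 from
    ContinuousLinearMap.ext (a.P_adjoint_P_of_ne h), map_zero_left]
  rfl

theorem map_P_adjoint_P₀ (i : I) (ξ : a.H₀ ⊗ₕ E) :
    map (a.P i) (.id ℂ E) (map a.P₀.adjoint (.id ℂ E) ξ) = 0 := by
  rw [map_comp_apply, show a.P i ∘L a.P₀.adjoint = 0 from
    ContinuousLinearMap.ext (a.P_adjoint_P₀ i), map_zero_left]
  rfl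

variable [CompleteSpace E]

theorem inner_map_adjoint_P_left (i : I) (ξ : (a.A i ⊗ₕ a.B i) ⊗ₕ E) (φ : H ⊗ₕ E) :
    ⟪map (a.P i).adjoint (.id ℂ E) ξ, φ⟫_ℂ = ⟪ξ, map (a.P i) (.id ℂ E) φ⟫_ℂ := by
  rw [inner_map_left, ContinuousLinearMap.adjoint_adjoint, ContinuousLinearMap.adjoint_id]

/-- Bessel gives convergence without knowing the limit. The limit is then found by pairing with `η ⊗
e`, which moves the series onto the expansion of `η` in `H`. -/
theorem hasSum_map_adjoint_P (φ : H ⊗ₕ E) :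
    HasSum (fun i => map (a.P i).adjoint (.id ℂ E) (map (a.P i) (.id ℂ E) φ))
      (φ - map a.P₀.adjoint (.id ℂ E) (map a.P₀ (.id ℂ E) φ)) := by
  have hs : Summable fun i => map (a.P i).adjoint (.id ℂ E) (map (a.P i) (.id ℂ E) φ) := by
    refine summable_of_orthogonal_of_inner_eq _ φ (fun i k h => ?_) fun i => ?_
    · rw [inner_map_adjoint_P_left, map_P_adjoint_P_of_ne _ h, inner_zero_right]
    · rw [inner_map_adjoint_P_left, inner_map_adjoint_P_left, map_P_adjoint_P_self]
  obtain ⟨s, hs⟩ := hs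
  convert hs using 1
  refine ext_inner_tmul fun η e => ?_
  have h1 := hs.mapL (innerSL ℂ (tmul η e))
  have h2 := ((a.hasSum_adjoint_P η).mapL (innerSL ℂ φ ∘L (tmulL H E).flip e)).star
  simp only [ContinuousLinearMap.comp_apply, ContinuousLinearMap.flip_apply, tmulL_apply,
    innerSL_apply_apply, Complex.star_def, inner_conj_symm] at h1 h2
  have h3 : ∀ i, ⟪tmul η e, map (a.P i).adjoint (.id ℂ E) (map (a.P i) (.id ℂ E) φ)⟫_ℂ =
      ⟪tmul ((a.P i).adjoint (a.P i η)) e, φ⟫_ℂ := fun i => by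
    rw [inner_map_right, inner_map_right, ContinuousLinearMap.adjoint_adjoint, ContinuousLinearMap.adjoint_id,
      map_tmul, map_tmul]
    rfl
  simp only [h3] at h1
  rw [h1.unique h2, inner_sub_right, inner_map_right, inner_map_right,
    ContinuousLinearMap.adjoint_adjoint, ContinuousLinearMap.adjoint_id, map_tmul, map_tmul, ← tmulL_apply (η - _),
    map_sub, sub_apply, inner_sub_left]
  rfl

end Ampliation

end AtomicPresentation

/-! ### From `Φ(𝒜) ⊆ 𝒞` to a minimal normal form -/

section NormalFormExistence

open HilbertTensor ContinuousLinearMap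

variable {HA HC HE : Type u}
  [NormedAddCommGroup HA] [InnerProductSpace ℂ HA] [CompleteSpace HA]
  [NormedAddCommGroup HC] [InnerProductSpace ℂ HC]
  [NormedAddCommGroup HE] [InnerProductSpace ℂ HE]
  {𝒜 : WeaklyClosedStarAlgebra HA} {I : Type v} {J : Type w}

/-- The `i`-th component `HC → A i ⊗ (B i ⊗ HE)` of `V : HC → HA ⊗ HE`. -/
def component (a : AtomicPresentation 𝒜 I) (V : HC →L[ℂ] HA ⊗ₕ HE) (i : I) :
    HC →L[ℂ] a.A i ⊗ₕ (a.B i ⊗ₕ HE) :=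
  (assoc (a.A i) (a.B i) HE : (a.A i ⊗ₕ a.B i) ⊗ₕ HE →L[ℂ] a.A i ⊗ₕ (a.B i ⊗ₕ HE)) ∘L
    map (a.P i) (.id ℂ HE) ∘L V

theorem component_apply (a : AtomicPresentation 𝒜 I) (V : HC →L[ℂ] HA ⊗ₕ HE) (i : I) (η : HC) :
    component a V i η = assoc (a.A i) (a.B i) HE (map (a.P i) (.id ℂ HE) (V η)) := rfl

variable [CompleteSpace HC] [CompleteSpace HE] {𝒞 : WeaklyClosedStarAlgebra HC}
  (a : AtomicPresentation 𝒜 I) (c : AtomicPresentation 𝒞 J) (V : HC →L[ℂ] HA ⊗ₕ HE)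

/-- Rebracketing turns `(x ⊗ 1) ⊗ 1` into `x ⊗ 1`, so `B i ⊗ HE` acts as the environment of the full
algebra `L(A i)`. -/
theorem inner_component (i : I) (x : a.A i →L[ℂ] a.A i) (η η' : HC) :
    ⟪component a V i η, map x (.id ℂ (a.B i ⊗ₕ HE)) (component a V i η')⟫_ℂ =
      ⟪η, (adjoint V ∘L map ((a.P i).adjoint ∘L map x (.id ℂ (a.B i)) ∘L a.P i) (.id ℂ HE) ∘L
        V) η'⟫_ℂ := by
  rw [component_apply, component_apply, ← map_id_id, ← assoc_map,
    LinearIsometryEquiv.inner_map_map, comp_apply, adjoint_inner_right, comp_apply,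
    inner_map_left, adjoint_id, map_comp_apply, map_comp_apply]
  rfl

/-- The map `X ↦ V† (X ⊗ 1) V` sends `𝒜` to `𝒞`. -/
def MapsAlgebra (𝒜 : WeaklyClosedStarAlgebra HA) (𝒞 : WeaklyClosedStarAlgebra HC)
    (V : HC →L[ℂ] HA ⊗ₕ HE) : Prop :=
  ∀ X ∈ 𝒜.carrier, adjoint V ∘L map X (.id ℂ HE) ∘L V ∈ 𝒞.carrier

variable {a V}

theorem MapsAlgebra.inner_component_mem (h : MapsAlgebra 𝒜 𝒞 V) (i : I)
    (x : a.A i →L[ℂ] a.A i) : ∃ S ∈ 𝒞.carrier, ∀ η η' : HC,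
      ⟪component a V i η, map x (.id ℂ (a.B i ⊗ₕ HE)) (component a V i η')⟫_ℂ = ⟪η, S η'⟫_ℂ :=
  ⟨_, h _ (a.adjoint_P_comp_map_mem i x), inner_component a V i x⟩

theorem MapsAlgebra.inner_component_self (h : MapsAlgebra 𝒜 𝒞 V) (i : I) :
    ∃ S ∈ 𝒞.carrier, ∀ η η' : HC,
      ⟪component a V i η, component a V i η'⟫_ℂ = ⟪η, S η'⟫_ℂ := by
  obtain ⟨S, hS, h⟩ := h.inner_component_mem i (.id ℂ (a.A i))
  exact ⟨S, hS, fun η η' => by rw [← h, map_id_id, id_apply]⟩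

/-- The squared norm is a matrix element on the null part of some `S ∈ 𝒞`, and `P₀ S = 0`. -/
theorem MapsAlgebra.component_adjoint_P₀ (h : MapsAlgebra 𝒜 𝒞 V) (i : I) (ξ : c.H₀) :
    component a V i (c.P₀.adjoint ξ) = 0 := by
  obtain ⟨S, hS, h⟩ := h.inner_component_self (a := a) i
  rw [← inner_self_eq_zero (𝕜 := ℂ), h, adjoint_inner_left, ((c.mem_carrier_iff S).1 hS).1,
    inner_zero_right]

/-- Elements of `𝒞` are block diagonal with entries `y j ⊗ 1`. Since `P j (P l)†` is the identity or
zero, one formula covers the diagonal and the off-diagonal case. -/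
theorem MapsAlgebra.inner_component_adjoint_P (h : MapsAlgebra 𝒜 𝒞 V) (i : I)
    (x : a.A i →L[ℂ] a.A i) : ∃ y : ∀ j, c.A j →L[ℂ] c.A j, ∀ j l ζ ζ',
      ⟪component a V i ((c.P j).adjoint ζ),
        map x (.id ℂ (a.B i ⊗ₕ HE)) (component a V i ((c.P l).adjoint ζ'))⟫_ℂ =
      ⟪ζ, map (y j) (.id ℂ (c.B j)) (c.P j ((c.P l).adjoint ζ'))⟫_ℂ := by
  obtain ⟨S, hS, h⟩ := h.inner_component_mem i x
  obtain ⟨y, -, hy⟩ := ((c.mem_carrier_iff S).1 hS).2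
  exact ⟨y, fun j l ζ ζ' => by rw [h, adjoint_inner_left, hy]⟩

theorem MapsAlgebra.exists_factorization (h : MapsAlgebra 𝒜 𝒞 V) (i : I) (j : J) :
    ∃ (F : Submodule ℂ (a.B i ⊗ₕ HE)) (_ : CompleteSpace F)
      (_ : TopologicalSpace.SeparableSpace F)
      (T : c.A j →L[ℂ] a.A i ⊗ₕ F) (U : F ⊗ₕ c.B j →ₗᵢ[ℂ] a.B i ⊗ₕ HE),
      (∀ ζ, semilocalizable U.toContinuousLinearMap T ζ =
        map (a.P i) (.id ℂ HE) (V ((c.P j).adjoint ζ))) ∧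
      IsTotalSet {ξ : a.A i ⊗ₕ F | ∃ (X : a.A i →L[ℂ] a.A i) (ψ : c.A j),
        ξ = map X (.id ℂ F) (T ψ)} ∧
      ∀ z, (∀ x ζ, ⟪slice x (component a V i ((c.P j).adjoint ζ)), z⟫_ℂ = 0) →
        ∀ f, ⟪U f, z⟫_ℂ = 0 := by
  obtain ⟨F, h1, h2, T, U, hW, hT, hU⟩ :=
    exists_semilocalization (component a V i ∘L (c.P j).adjoint) (fun X => by
      obtain ⟨y, hy⟩ := h.inner_component_adjoint_P c i X
      exact ⟨y j, fun ζ ζ' => by rw [comp_apply, comp_apply, hy, c.P_adjoint_P_self]⟩)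
  refine ⟨F, h1, h2, T, U, fun ζ => ?_, hT, hU⟩
  apply (assoc (a.A i) (a.B i) HE).injective
  rw [← component_apply]
  refine Eq.trans ?_ (hW ζ)
  exact (assoc (a.A i) (a.B i) HE).apply_symm_apply _

theorem MapsAlgebra.inner_slice_component_of_ne (h : MapsAlgebra 𝒜 𝒞 V) (i : I) {k l : J}
    (hkl : k ≠ l) (x x' : a.A i) (ζ : c.A k ⊗ₕ c.B k) (ζ' : c.A l ⊗ₕ c.B l) :
    ⟪slice x (component a V i ((c.P k).adjoint ζ)),
      slice x' (component a V i ((c.P l).adjoint ζ'))⟫_ℂ = 0 := by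
  obtain ⟨y, hy⟩ := h.inner_component_adjoint_P c i (InnerProductSpace.rankOne ℂ x x')
  rw [inner_slice_slice, hy, c.P_adjoint_P_of_ne hkl, map_zero, inner_zero_right]

/-- Terms with different `i` are orthogonal by the blocks of `𝒜`; terms with equal `i` and different
`j` are orthogonal because `W_i† W_i ∈ 𝒞` is block diagonal. Bessel against `V η` gives summability
over pairs, and the value follows by summing over `j` first. -/
theorem MapsAlgebra.hasSum (h : MapsAlgebra 𝒜 𝒞 V) (η : HC) :
    HasSum (fun p : I × J => map (a.P p.1).adjoint (.id ℂ HE)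
        (map (a.P p.1) (.id ℂ HE) (V ((c.P p.2).adjoint (c.P p.2 η)))))
      (V η - map a.P₀.adjoint (.id ℂ HE) (map a.P₀ (.id ℂ HE) (V η))) := by
  have hin : ∀ i η η', ⟪map (a.P i) (.id ℂ HE) (V η), map (a.P i) (.id ℂ HE) (V η')⟫_ℂ =
      ⟪component a V i η, component a V i η'⟫_ℂ := fun i η η' => by
    rw [component_apply, component_apply, LinearIsometryEquiv.inner_map_map]
  have hz : ∀ i ξ, map (a.P i) (.id ℂ HE) (V (c.P₀.adjoint ξ)) = 0 := fun i ξ => by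
    rw [← inner_self_eq_zero (𝕜 := ℂ), hin, h.component_adjoint_P₀, inner_zero_left]
  have hs : Summable fun p : I × J => map (a.P p.1).adjoint (.id ℂ HE)
      (map (a.P p.1) (.id ℂ HE) (V ((c.P p.2).adjoint (c.P p.2 η)))) := by
    refine summable_of_orthogonal_of_inner_eq _ (V η) ?_ ?_
    · rintro ⟨i, j⟩ ⟨k, l⟩ hne
      rw [a.inner_map_adjoint_P_left]
      rcases eq_or_ne i k with rfl | hik
      · have hjl : j ≠ l := fun hjl => hne (by rw [hjl])
        obtain ⟨S, hS, h⟩ := h.inner_component_self (a := a) i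
        obtain ⟨y, -, hy⟩ := ((c.mem_carrier_iff S).1 hS).2
        rw [a.map_P_adjoint_P_self, hin, h, adjoint_inner_left, hy, c.P_adjoint_P_of_ne hjl,
          map_zero, inner_zero_right]
      · rw [a.map_P_adjoint_P_of_ne hik, inner_zero_right]
    · rintro ⟨i, j⟩
      rw [a.inner_map_adjoint_P_left, a.inner_map_adjoint_P_left, a.map_P_adjoint_P_self]
      obtain ⟨S, hS, h⟩ := h.inner_component_self (a := a) i
      obtain ⟨y, -, hy⟩ := ((c.mem_carrier_iff S).1 hS).2
      rw [hin, hin, h, h, adjoint_inner_left, adjoint_inner_left, hy, hy, c.P_adjoint_P_self]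
  obtain ⟨s, hs⟩ := hs
  -- The sum over `j` misses only the null part of `η`, which `hz` shows to contribute nothing.
  have hfib : ∀ i, HasSum (fun j => map (a.P i).adjoint (.id ℂ HE)
      (map (a.P i) (.id ℂ HE) (V ((c.P j).adjoint (c.P j η)))))
      (map (a.P i).adjoint (.id ℂ HE) (map (a.P i) (.id ℂ HE) (V η))) := fun i => by
    have := (c.hasSum_adjoint_P η).mapL
      (map (a.P i).adjoint (.id ℂ HE) ∘L map (a.P i) (.id ℂ HE) ∘L V)
    simpa only [comp_apply, map_sub, hz, map_zero, sub_zero] using this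
  rwa [(hs.prod_fiberwise hfib).unique (a.hasSum_map_adjoint_P (V η))] at hs

theorem MapsAlgebra.exists_normalForm_isMinimal (h : MapsAlgebra 𝒜 𝒞 V) :
    ∃ N : NormalForm a c V, N.IsMinimal := by
  choose F h1 h2 T U hTU hT hU using fun i j => h.exists_factorization (a := a) c i j
  have hiso : ∀ i j, adjoint (U i j).toContinuousLinearMap ∘L (U i j).toContinuousLinearMap =
      .id ℂ (F i j ⊗ₕ c.B j) := fun i j => by
    ext1 f
    exact ext_inner_left ℂ fun g => by
      rw [comp_apply, adjoint_inner_right, id_apply]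
      exact (U i j).inner_map_map g f
  have hort : ∀ i k l, k ≠ l →
      adjoint (U i k).toContinuousLinearMap ∘L (U i l).toContinuousLinearMap = 0 :=
    fun i k l hkl => by
      ext1 f
      refine ext_inner_left ℂ fun g => ?_
      rw [comp_apply, adjoint_inner_right, zero_apply, inner_zero_right]
      -- The orthogonality clause is used twice: slices from block `k` are orthogonal to those from
      -- `l`, hence to the range of `U i l`, which is then orthogonal to the range of `U i k`.
      refine hU i k _ (fun x ζ => ?_) g
      rw [← inner_conj_symm, LinearIsometry.coe_toContinuousLinearMap,
        hU i l _ (fun x' ζ' => h.inner_slice_component_of_ne c i hkl.symm x' x ζ' ζ) f, map_zero]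
  refine ⟨{
    V₀ := map a.P₀ (.id ℂ HE) ∘L V
    F := fun i j => F i j
    T := T
    U := fun i j => (U i j).toContinuousLinearMap
    isometry_U := fun i j => (U i j).norm_map
    hasSum := fun η => ?_
    adjoint_U_comp_self := hiso
    adjoint_U_comp_of_ne := hort }, hT⟩
  have := h.hasSum (a := a) c η
  simp only [← hTU] at this
  exact this

end NormalFormExistence

/-! ### From a normal form back to `Φ(𝒜) ⊆ 𝒞` -/

section NormalFormConverse

open HilbertTensor ContinuousLinearMap

theorem semilocalizable_apply {A B C D E F : Type u}
    [NormedAddCommGroup A] [InnerProductSpace ℂ A]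
    [NormedAddCommGroup B] [InnerProductSpace ℂ B]
    [NormedAddCommGroup C] [InnerProductSpace ℂ C]
    [NormedAddCommGroup D] [InnerProductSpace ℂ D]
    [NormedAddCommGroup E] [InnerProductSpace ℂ E]
    [NormedAddCommGroup F] [InnerProductSpace ℂ F]
    (U : F ⊗ₕ D →L[ℂ] B ⊗ₕ E) (T : C →L[ℂ] A ⊗ₕ F) (ζ : C ⊗ₕ D) :
    assoc A B E (semilocalizable U T ζ) = map (.id ℂ A) U (assoc A F D (map T (.id ℂ D) ζ)) :=
  (assoc A B E).apply_symm_apply _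

/-- The sesquilinear form of `(X ⊗ 1) ⊗ 1` between the ranges of two semilocalizable operators. -/
theorem inner_semilocalizable {A B C C' D D' E F F' : Type u}
    [NormedAddCommGroup A] [InnerProductSpace ℂ A] [CompleteSpace A]
    [NormedAddCommGroup B] [InnerProductSpace ℂ B]
    [NormedAddCommGroup C] [InnerProductSpace ℂ C]
    [NormedAddCommGroup C'] [InnerProductSpace ℂ C']
    [NormedAddCommGroup D] [InnerProductSpace ℂ D]
    [NormedAddCommGroup D'] [InnerProductSpace ℂ D']
    [NormedAddCommGroup E] [InnerProductSpace ℂ E]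
    [NormedAddCommGroup F] [InnerProductSpace ℂ F]
    [NormedAddCommGroup F'] [InnerProductSpace ℂ F']
    (U : F ⊗ₕ D →L[ℂ] B ⊗ₕ E) (T : C →L[ℂ] A ⊗ₕ F) (U' : F' ⊗ₕ D' →L[ℂ] B ⊗ₕ E)
    (T' : C' →L[ℂ] A ⊗ₕ F') (X : A →L[ℂ] A) (ζ : C ⊗ₕ D) (ζ' : C' ⊗ₕ D') :
    ⟪semilocalizable U T ζ, map (map X (.id ℂ B)) (.id ℂ E) (semilocalizable U' T' ζ')⟫_ℂ =
      ⟪assoc A F D (map T (.id ℂ D) ζ),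
        map X (adjoint U ∘L U') (assoc A F' D' (map T' (.id ℂ D') ζ'))⟫_ℂ := by
  rw [← (assoc A B E).inner_map_map, assoc_map, semilocalizable_apply, semilocalizable_apply,
    map_id_id, inner_map_left, ContinuousLinearMap.adjoint_id, map_comp_apply, map_comp_apply]
  rfl

variable {HA HC HE : Type u}
  [NormedAddCommGroup HA] [InnerProductSpace ℂ HA] [CompleteSpace HA]
  [NormedAddCommGroup HC] [InnerProductSpace ℂ HC] [CompleteSpace HC]
  [NormedAddCommGroup HE] [InnerProductSpace ℂ HE]
  {𝒜 : WeaklyClosedStarAlgebra HA} {𝒞 : WeaklyClosedStarAlgebra HC}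
  {I : Type v} {J : Type w}
  {a : AtomicPresentation 𝒜 I} {c : AtomicPresentation 𝒞 J} {V : HC →L[ℂ] HA ⊗ₕ HE}

namespace NormalForm

theorem hasSum_map_P (N : NormalForm a c V) (i : I) (η : HC) :
    HasSum (fun p : I × J => map (a.P i) (.id ℂ HE) (map (a.P p.1).adjoint (.id ℂ HE)
      (semilocalizable (N.U p.1 p.2) (N.T p.1 p.2) (c.P p.2 η))))
      (map (a.P i) (.id ℂ HE) (V η)) := by
  have h := (N.hasSum η).mapL (map (a.P i) (.id ℂ HE))
  simp only [sub_apply, comp_apply, map_sub, a.map_P_adjoint_P₀, sub_zero] at h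
  exact h

theorem map_P_adjoint_P₀ (N : NormalForm a c V) (i : I) (ξ : c.H₀) :
    map (a.P i) (.id ℂ HE) (V (c.P₀.adjoint ξ)) = 0 := by
  have h := N.hasSum_map_P i (c.P₀.adjoint ξ)
  simp only [c.P_adjoint_P₀, map_zero] at h
  exact h.unique hasSum_zero

/-- Only the term `(i, j)` of the series survives restriction to block `j` and compression to block
`i`. -/
theorem map_P_adjoint_P (N : NormalForm a c V) (i : I) (j : J) (ζ : c.A j ⊗ₕ c.B j) :
    map (a.P i) (.id ℂ HE) (V ((c.P j).adjoint ζ)) = semilocalizable (N.U i j) (N.T i j) ζ := by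
  refine (N.hasSum_map_P i ((c.P j).adjoint ζ)).unique ?_
  have h := hasSum_single (f := fun p : I × J => map (a.P i) (.id ℂ HE)
    (map (a.P p.1).adjoint (.id ℂ HE) (semilocalizable (N.U p.1 p.2) (N.T p.1 p.2)
      (c.P p.2 ((c.P j).adjoint ζ))))) (i, j) ?_
  · rwa [c.P_adjoint_P_self, a.map_P_adjoint_P_self] at h
  · rintro ⟨k, l⟩ hne
    rcases eq_or_ne i k with rfl | hik
    · have hlj : l ≠ j := fun hlj => hne (by rw [hlj])
      simp only [c.P_adjoint_P_of_ne hlj, map_zero]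
    · exact a.map_P_adjoint_P_of_ne hik _

end NormalForm

variable [CompleteSpace HE]

/-- The sesquilinear form of `V† (X ⊗ 1) V` as the sum of the contributions of the blocks. -/
theorem hasSum_inner_of_blocks (V : HC →L[ℂ] HA ⊗ₕ HE) {X : HA →L[ℂ] HA}
    (h₀ : ∀ η, a.P₀ (X η) = 0) {x : ∀ i, a.A i →L[ℂ] a.A i}
    (hx : ∀ i η, a.P i (X η) = map (x i) (.id ℂ (a.B i)) (a.P i η)) (η η' : HC) :
    HasSum (fun i => ⟪map (a.P i) (.id ℂ HE) (V η),
        map (map (x i) (.id ℂ (a.B i))) (.id ℂ HE) (map (a.P i) (.id ℂ HE) (V η'))⟫_ℂ)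
      ⟪η, (adjoint V ∘L map X (.id ℂ HE) ∘L V) η'⟫_ℂ := by
  have h := (a.hasSum_map_adjoint_P (map X (.id ℂ HE) (V η'))).mapL (innerSL ℂ (V η))
  have h1 : map a.P₀ (.id ℂ HE) (map X (.id ℂ HE) (V η')) = 0 := by
    rw [map_comp_apply, show a.P₀ ∘L X = 0 from ContinuousLinearMap.ext h₀, map_zero_left]
    rfl
  have h2 : ∀ i, map (a.P i) (.id ℂ HE) (map X (.id ℂ HE) (V η')) =
      map (map (x i) (.id ℂ (a.B i))) (.id ℂ HE) (map (a.P i) (.id ℂ HE) (V η')) := fun i => by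
    rw [map_comp_apply, map_comp_apply,
      show a.P i ∘L X = map (x i) (.id ℂ (a.B i)) ∘L a.P i from ContinuousLinearMap.ext (hx i)]
  have h3 : ∀ i ξ, ⟪V η, map (a.P i).adjoint (.id ℂ HE) ξ⟫_ℂ =
      ⟪map (a.P i) (.id ℂ HE) (V η), ξ⟫_ℂ := fun i ξ => by
    rw [inner_map_right, ContinuousLinearMap.adjoint_adjoint, ContinuousLinearMap.adjoint_id]
  simp only [h1, h2, map_zero, sub_zero, innerSL_apply_apply, h3] at h
  rwa [comp_apply, adjoint_inner_right]

theorem NormalForm.mapsAlgebra (N : NormalForm a c V) : MapsAlgebra 𝒜 𝒞 V := by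
  intro X hX
  obtain ⟨h₀, x, -, hx⟩ := (a.mem_carrier_iff X).1 hX
  have hsum := hasSum_inner_of_blocks V h₀ hx
  set S := adjoint V ∘L map X (.id ℂ HE) ∘L V
  clear_value S
  have hS₀ : ∀ η, c.P₀ (S η) = 0 := fun η => ext_inner_left ℂ fun ξ => by
    have h := hsum (c.P₀.adjoint ξ) η
    simp only [N.map_P_adjoint_P₀, inner_zero_left] at h
    rw [← adjoint_inner_left, inner_zero_right]
    exact h.unique hasSum_zero
  have hS₀' : ∀ ξ, S (c.P₀.adjoint ξ) = 0 := fun ξ => ext_inner_left ℂ fun η => by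
    have h := hsum η (c.P₀.adjoint ξ)
    simp only [N.map_P_adjoint_P₀, map_zero, inner_zero_right] at h
    rw [inner_zero_right]
    exact h.unique hasSum_zero
  -- Every contribution to this entry contains `U i j† U i l = 0`.
  have hne : ∀ j l, l ≠ j → ∀ ζ, c.P j (S ((c.P l).adjoint ζ)) = 0 := fun j l hlj ζ =>
    ext_inner_left ℂ fun ζ' => by
      have h := hsum ((c.P j).adjoint ζ') ((c.P l).adjoint ζ)
      simp only [N.map_P_adjoint_P, inner_semilocalizable, N.adjoint_U_comp_of_ne _ _ _ hlj.symm,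
        map_zero_right, zero_apply, inner_zero_right] at h
      rw [← adjoint_inner_left, inner_zero_right]
      exact h.unique hasSum_zero
  have hdiag : ∀ j, ∃ Y : c.A j →L[ℂ] c.A j, ‖Y‖ ≤ ‖c.P j ∘L S ∘L (c.P j).adjoint‖ ∧
      c.P j ∘L S ∘L (c.P j).adjoint = map Y (.id ℂ (c.B j)) := fun j =>
    exists_eq_map_id _
      -- `U i j† U i j = 1` leaves this form times `⟪d, d'⟫`. Its own summability is not needed: the
      -- scalar factor passes through `tsum` in any case, and the operator is already bounded.
      (fun ψ ψ' => ∑' i, ⟪N.T i j ψ, map (x i) (.id ℂ (N.F i j)) (N.T i j ψ')⟫_ℂ)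
      fun ψ d ψ' d' => by
        have h := hsum ((c.P j).adjoint (tmul ψ d)) ((c.P j).adjoint (tmul ψ' d'))
        simp only [N.map_P_adjoint_P, inner_semilocalizable, N.adjoint_U_comp_self,
          ← map_id_id, ← assoc_map, LinearIsometryEquiv.inner_map_map, map_tmul, inner_tmul,
          id_apply] at h
        rw [comp_apply, comp_apply, ← adjoint_inner_left, ← tsum_mul_right]
        exact h.tsum_eq.symm
  choose y hy hyS using hdiag
  refine (c.mem_carrier_iff S).2 ⟨hS₀, y, ⟨‖S‖, ?_⟩, fun j η => ?_⟩
  · rintro _ ⟨j, rfl⟩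
    exact (hy j).trans (c.norm_P_comp_comp_adjoint_P_le j S)
  · have : c.P j ∘L S = map (y j) (.id ℂ (c.B j)) ∘L c.P j := by
      -- Testing on each summand of `HC` needs `S` to vanish on the null part (`hS₀'`) as well as to
      -- have range orthogonal to it (`hS₀`).
      refine c.ext_adjoint (fun ξ => ?_) fun l ζ => ?_
      · rw [comp_apply, comp_apply, hS₀', map_zero, c.P_adjoint_P₀, map_zero]
      · rw [comp_apply, comp_apply]
        rcases eq_or_ne l j with rfl | hlj
        · rw [c.P_adjoint_P_self, ← hyS]
          rfl
        · rw [hne j l hlj, c.P_adjoint_P_of_ne hlj.symm, map_zero]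
    exact congrArg (fun T => T η) this

end NormalFormConverse

end

theorem mainTheorem2 {HA HC HE : Type u}
    [NormedAddCommGroup HA] [InnerProductSpace ℂ HA] [CompleteSpace HA]
    [TopologicalSpace.SeparableSpace HA]
    [NormedAddCommGroup HC] [InnerProductSpace ℂ HC] [CompleteSpace HC]
    [TopologicalSpace.SeparableSpace HC]
    [NormedAddCommGroup HE] [InnerProductSpace ℂ HE] [CompleteSpace HE]
    [TopologicalSpace.SeparableSpace HE]
    (𝒜 : WeaklyClosedStarAlgebra HA) (𝒞 : WeaklyClosedStarAlgebra HC)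
    {I : Type v} {J : Type w}
    (a : AtomicPresentation 𝒜 I) (c : AtomicPresentation 𝒞 J)
    (V : HC →L[ℂ] HA ⊗ₕ HE)
    (Φ : (HA →L[ℂ] HA) →ₗ[ℂ] (HC →L[ℂ] HC))
    (hΦ : ∀ X, Φ X =
      ContinuousLinearMap.adjoint V ∘L HilbertTensor.map X (.id ℂ HE) ∘L V) :
    ((∀ X ∈ 𝒜.carrier, Φ X ∈ 𝒞.carrier) ↔ Nonempty (NormalForm a c V)) ∧
    (Nonempty (NormalForm a c V) → ∃ N : NormalForm a c V, N.IsMinimal) := by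
  have hiff : (∀ X ∈ 𝒜.carrier, Φ X ∈ 𝒞.carrier) ↔ MapsAlgebra 𝒜 𝒞 V := by
    simp only [hΦ, MapsAlgebra]
  rw [hiff]
  refine ⟨⟨fun h => ?_, fun ⟨N⟩ => N.mapsAlgebra⟩, fun ⟨N⟩ =>
    N.mapsAlgebra.exists_normalForm_isMinimal c⟩
  obtain ⟨N, -⟩ := h.exists_normalForm_isMinimal c
  exact ⟨N⟩
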